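/- Let $\mathbb{K}=\mathbb{R}$ or $\mathbb{C}$, let $(X_n)_{n\in\mathbb{N}}$ be a sequence of normed linear spaces over $\mathbb{K}$, and let $\bigoplus_2 X_n$ be the space of all sequences $x=(x_n)_{n}$ with $x_n\in X_n$ and $\sum_n\|x_n\|^2<\infty$, with the norm $\|x\|_2=\left(\sum_n\|x_n\|^2\right)^{1/2}$. In a normed space $X$ over $\mathbb{K}$, write $u\perp_B v$ (Birkhoff–James orthogonality) if $\|u+\lambda v\|\ge\|u\|$ for every $\lambda\in\mathbb{K}$. A point $u\in X$ is *left-symmetric* (resp. *right-symmetric*) if for every $v\in X$, $u\perp_B v$ implies $v\perp_B u$ (resp. $v\perp_B u$ implies $u\perp_B v$). A *semi-inner product* on $X$ is a map $[\cdot,\cdot]:X\times X\to\mathbb{K}$ such that, for all $u,v,w\in X$ and $\lambda\in\mathbb{K}$: $[u,u]=\|u\|^2$, $[u,v+\lambda w]=[u,v]+\lambda[u,w]$, $[\lambda u,v]=\overline{\lambda}[u,v]$, and $|[u,v]|^2\le[u,u][v,v]$. A point $u\in X$ is *left s.i.p. symmetric* (resp. *right s.i.p. symmetric*) if for every nonzero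 $v\in X$ and every semi-inner product $[\cdot,\cdot]$ on $X$ there is a semi-inner product $[\cdot,\cdot]'$ on $X$ with $[v,u]'=\overline{[u,v]}$ (resp. $[v,u]=\overline{[u,v]'}$). Let $x=(x_n)_{n}\in\bigoplus_2 X_n$. Then: 1. $x$ is left-symmetric in $\bigoplus_2 X_n$ if and only if either $x_n$ is left s.i.p. symmetric in $X_n$ for every $n\in\mathbb{N}$, or there is $n_0\in\mathbb{N}$ such that $x_n=0$ for all $n\neq n_0$ and $x_{n_0}$ is a left-symmetric point of $X_{n_0}$. 2. $x$ is right-symmetric in $\bigoplus_2 X_n$ if and only if either $x_n$ is right s.i.p. symmetric in $X_n$ for every $n\in\mathbb{N}$, or there is $n_0\in\mathbb{N}$ such that $x_n=0$ for all $n\neq n_0$ and $x_{n_0}$ is a right-symmetric point of $X_{n_0}$. -/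

import Mathlib

/-- Birkhoff–James orthogonality `x ⊥_B y` in a normed space over `𝕜`. -/
def BirkhoffOrthogonal (𝕜 : Type*) {E : Type*} [RCLike 𝕜] [NormedAddCommGroup E]
    [NormedSpace 𝕜 E] (x y : E) : Prop :=
  ∀ c : 𝕜, ‖x‖ ≤ ‖x + c • y‖

/-- `x` is a left-symmetric point: `x ⊥_B y` implies `y ⊥_B x`. -/
def IsLeftSymmetric (𝕜 : Type*) {E : Type*} [RCLike 𝕜] [NormedAddCommGroup E]
    [NormedSpace 𝕜 E] (x : E) : Prop :=
  ∀ y : E, BirkhoffOrthogonal 𝕜 x y → BirkhoffOrthogonal 𝕜 y x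

/-- `x` is a right-symmetric point: `y ⊥_B x` implies `x ⊥_B y`. -/
def IsRightSymmetric (𝕜 : Type*) {E : Type*} [RCLike 𝕜] [NormedAddCommGroup E]
    [NormedSpace 𝕜 E] (x : E) : Prop :=
  ∀ y : E, BirkhoffOrthogonal 𝕜 y x → BirkhoffOrthogonal 𝕜 x y

open scoped ComplexOrder in
/-- Semi-inner products on a vector space, linear in the second variable. The order on `𝕜` is
`0 ≤ z ↔ 0 ≤ re z ∧ im z = 0`. -/
structure IsSemiInnerProduct (𝕜 : Type*) {V : Type*} [RCLike 𝕜] [AddCommGroup V]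
    [Module 𝕜 V] (s : V → V → 𝕜) : Prop where
  self_nonneg : ∀ x, 0 ≤ s x x
  self_eq_zero_iff : ∀ x, s x x = 0 ↔ x = 0
  add_mul_right : ∀ (x y z : V) (c : 𝕜), s x y + c * s x z = s x (y + c • z)
  smul_left : ∀ (c : 𝕜) (x y : V), s (c • x) y = starRingEnd 𝕜 c * s x y
  norm_sq_le : ∀ x y, ‖s x y‖ ^ 2 ≤ RCLike.re (s x x) * RCLike.re (s y y)

/-- Semi-inner products on a normed space: those that induce its norm, `[x, x] = ‖x‖²`. -/
structure IsNormSemiInnerProduct (𝕜 : Type*) {E : Type*} [RCLike 𝕜] [NormedAddCommGroup E]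
    [NormedSpace 𝕜 E] (s : E → E → 𝕜) : Prop extends IsSemiInnerProduct 𝕜 s where
  self_eq_norm_sq : ∀ x, s x x = ((‖x‖ ^ 2 : ℝ) : 𝕜)

/-- `x` is `p`-left s.i.p. commuting with `y`: for every semi-inner product `s` there is a
semi-inner product `t` with `t y x = |s x y / (‖x‖ ‖y‖)| ^ (p - 2) * conj (s x y)`.
(For `p = 2` the first factor is `1`, also when `x = 0`.) -/
def IsLeftSipCommuting (𝕜 : Type*) {E : Type*} [RCLike 𝕜] [NormedAddCommGroup E]
    [NormedSpace 𝕜 E] (p : ℝ) (x y : E) : Prop :=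
  ∀ s : E → E → 𝕜, IsNormSemiInnerProduct 𝕜 s →
    ∃ t : E → E → 𝕜, IsNormSemiInnerProduct 𝕜 t ∧
      t y x = (((‖s x y‖ / (‖x‖ * ‖y‖)) ^ (p - 2) : ℝ) : 𝕜) * starRingEnd 𝕜 (s x y)

/-- `x` is `p`-right s.i.p. commuting with `y`: for every semi-inner product `s` there is a
semi-inner product `t` with `s y x = |t x y / (‖x‖ ‖y‖)| ^ (p - 2) * conj (t x y)`. -/
def IsRightSipCommuting (𝕜 : Type*) {E : Type*} [RCLike 𝕜] [NormedAddCommGroup E]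
    [NormedSpace 𝕜 E] (p : ℝ) (x y : E) : Prop :=
  ∀ s : E → E → 𝕜, IsNormSemiInnerProduct 𝕜 s →
    ∃ t : E → E → 𝕜, IsNormSemiInnerProduct 𝕜 t ∧
      s y x = (((‖t x y‖ / (‖x‖ * ‖y‖)) ^ (p - 2) : ℝ) : 𝕜) * starRingEnd 𝕜 (t x y)

/-- Left s.i.p. symmetric points: `2`-left s.i.p. commuting with every nonzero `y`. -/
def IsLeftSipSymmetric (𝕜 : Type*) {E : Type*} [RCLike 𝕜] [NormedAddCommGroup E]
    [NormedSpace 𝕜 E] (x : E) : Prop :=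
  ∀ y : E, y ≠ 0 → IsLeftSipCommuting 𝕜 2 x y

/-- Right s.i.p. symmetric points: `2`-right s.i.p. commuting with every nonzero `y`. -/
def IsRightSipSymmetric (𝕜 : Type*) {E : Type*} [RCLike 𝕜] [NormedAddCommGroup E]
    [NormedSpace 𝕜 E] (x : E) : Prop :=
  ∀ y : E, y ≠ 0 → IsRightSipCommuting 𝕜 2 x y

/-! A semi-inner product is a conjugate-homogeneous choice of a support functional at every point,
and any one support functional extends to such a choice. So `u` is left s.i.p. symmetric iff for all
`v` and every support functional `f` at `u`, some support functional `g` at `v` has `g u = conj (f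
v)`; on the right the roles of `f` and `g` are exchanged. By James, `u ⊥_B v` iff some support
functional at `u` kills `v`. In the `ℓ²` sum these functionals split into coordinates: `x ⊥_B y` iff
`∑ fₙ (yₙ) = 0` for some support functionals `fₙ` at `xₙ`.

If all `xₙ` are s.i.p. symmetric, conjugating termwise reverses orthogonality. Conversely, let `xₘ ≠
0` with `m ≠ n`, and test with `v` in place `n` and `c • xₘ` in place `m`. Place `m` contributes `c
‖xₘ‖²` or its conjugate whatever the functional, so `c` can cancel any prescribed value at `n`, and
symmetry of `x` forces the conjugate value. If some `n` has no such `m`, everything happens in `X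
n`. -/

/-! ### Support functionals and Birkhoff–James orthogonality -/

section SupportFunctional

variable {𝕜 E : Type*} [RCLike 𝕜] [NormedAddCommGroup E] [NormedSpace 𝕜 E]

/-- `f` belongs to the image of `u` under the duality map: `f u = ‖u‖²` and `‖f‖ ≤ ‖u‖`. -/
structure IsSupportFunctional (u : E) (f : E →ₗ[𝕜] 𝕜) : Prop where
  norm_le : ∀ z, ‖f z‖ ≤ ‖u‖ * ‖z‖
  apply_self : f u = ((‖u‖ ^ 2 : ℝ) : 𝕜)

theorem IsSupportFunctional.zero_apply {f : E →ₗ[𝕜] 𝕜} (h : IsSupportFunctional (0 : E) f)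
    (z : E) : f z = 0 := by
  simpa using h.norm_le z

theorem IsSupportFunctional.apply_of_eq_zero {u : E} {f : E →ₗ[𝕜] 𝕜}
    (h : IsSupportFunctional u f) (hu : u = 0) (z : E) : f z = 0 := by
  subst hu
  exact h.zero_apply z

theorem IsSupportFunctional.smul {u : E} {f : E →ₗ[𝕜] 𝕜} (h : IsSupportFunctional u f) (c : 𝕜) :
    IsSupportFunctional (c • u) (starRingEnd 𝕜 c • f) where
  norm_le z := by
    simp only [LinearMap.smul_apply, smul_eq_mul, norm_mul, RCLike.norm_conj, norm_smul, mul_assoc]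
    exact mul_le_mul_of_nonneg_left (h.norm_le z) (norm_nonneg c)
  apply_self := by
    simp only [LinearMap.smul_apply, map_smul, smul_eq_mul, h.apply_self, norm_smul]
    rw [← mul_assoc, RCLike.mul_conj]
    push_cast
    ring

theorem IsSupportFunctional.smul_apply {u : E} {c : 𝕜} {g : E →ₗ[𝕜] 𝕜}
    (h : IsSupportFunctional (c • u) g) :
    g u = starRingEnd 𝕜 c * ((‖u‖ ^ 2 : ℝ) : 𝕜) := by
  rcases eq_or_ne c 0 with rfl | hc
  · simp [h.apply_of_eq_zero (zero_smul 𝕜 u) u]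
  · have h1 := h.apply_self
    rw [map_smul, smul_eq_mul, norm_smul, mul_pow] at h1
    apply mul_left_cancel₀ hc
    rw [h1, ← mul_assoc, RCLike.mul_conj]
    push_cast
    ring

theorem IsSupportFunctional.birkhoffOrthogonal {u v : E} {f : E →ₗ[𝕜] 𝕜}
    (h : IsSupportFunctional u f) (hv : f v = 0) : BirkhoffOrthogonal 𝕜 u v := by
  intro c
  rcases eq_or_ne u 0 with rfl | hu
  · simp
  · have h1 := h.norm_le (u + c • v)
    rw [map_add, map_smul, hv, smul_zero, add_zero, h.apply_self, RCLike.norm_ofReal,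
      abs_of_nonneg (by positivity), sq] at h1
    exact le_of_mul_le_mul_left h1 (norm_pos_iff.2 hu)

/-- James' characterization of Birkhoff–James orthogonality. -/
theorem BirkhoffOrthogonal.exists_isSupportFunctional {u v : E} (h : BirkhoffOrthogonal 𝕜 u v) :
    ∃ f : E →L[𝕜] 𝕜, IsSupportFunctional u (f : E →ₗ[𝕜] 𝕜) ∧ f v = 0 := by
  let S : Submodule 𝕜 E := Submodule.span 𝕜 {v}
  -- Orthogonality says that `u` keeps its norm modulo `v`; a Hahn–Banach functional on the quotient
  -- then kills `v`.
  have hnorm : ‖(Submodule.Quotient.mk u : E ⧸ S)‖ = ‖u‖ := by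
    refine le_antisymm (Submodule.Quotient.norm_mk_le S u) (le_of_forall_pos_lt_add fun ε hε => ?_)
    obtain ⟨m, hm, hlt⟩ := Submodule.Quotient.norm_mk_lt (Submodule.Quotient.mk u : E ⧸ S) hε
    refine lt_of_le_of_lt ?_ hlt
    rw [Submodule.Quotient.eq] at hm
    obtain ⟨c, hc⟩ := Submodule.mem_span_singleton.1 hm
    have : m = u + c • v := by rw [hc]; abel
    rw [this]
    exact h c
  obtain ⟨g, hg1, hg2⟩ := exists_dual_vector'' 𝕜 (Submodule.Quotient.mk u : E ⧸ S)
  have hbound : ∀ z, ‖((‖u‖ : 𝕜) • ((g : (E ⧸ S) →ₗ[𝕜] 𝕜) ∘ₗ S.mkQ)) z‖ ≤ ‖u‖ * ‖z‖ := by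
    intro z
    simp only [LinearMap.smul_apply, LinearMap.comp_apply, smul_eq_mul, norm_mul,
      RCLike.norm_ofReal, abs_norm, Submodule.mkQ_apply]
    refine mul_le_mul_of_nonneg_left ?_ (norm_nonneg u)
    refine (g.le_of_opNorm_le hg1 _).trans ?_
    rw [one_mul]
    exact Submodule.Quotient.norm_mk_le S z
  refine ⟨LinearMap.mkContinuous _ ‖u‖ hbound, ⟨hbound, ?_⟩, ?_⟩
  · change (‖u‖ : 𝕜) • g (Submodule.Quotient.mk u) = _
    rw [hg2, hnorm, smul_eq_mul]
    push_cast
    ring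
  · change (‖u‖ : 𝕜) • g (Submodule.Quotient.mk v) = 0
    rw [(Submodule.Quotient.mk_eq_zero S).2 (Submodule.mem_span_singleton_self v), map_zero,
      smul_zero]

theorem exists_isSupportFunctional (u : E) : ∃ f : E →ₗ[𝕜] 𝕜, IsSupportFunctional u f := by
  obtain ⟨f, hf, -⟩ := BirkhoffOrthogonal.exists_isSupportFunctional (𝕜 := 𝕜) (u := u) (v := 0)
    (fun c => by simp)
  exact ⟨_, hf⟩

/-- Subgradients of `½‖·‖²` at `u` are support functionals. -/
theorem IsSupportFunctional.of_subgradient {u : E} {f : E →ₗ[𝕜] 𝕜}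
    (h : ∀ z, RCLike.re (f (z - u)) ≤ (‖z‖ ^ 2 - ‖u‖ ^ 2) / 2) : IsSupportFunctional u f := by
  have hself : RCLike.re (f u) = ‖u‖ ^ 2 := by
    have key : ∀ t : ℝ, t * RCLike.re (f u) ≤ ((1 + t) ^ 2 - 1) / 2 * ‖u‖ ^ 2 := by
      intro t
      have := h (((1 + t : ℝ) : 𝕜) • u)
      have e : ((1 + t : ℝ) : 𝕜) • u - u = (t : 𝕜) • u := by
        push_cast
        rw [add_smul, one_smul]
        abel
      rw [e, map_smul, smul_eq_mul, RCLike.re_ofReal_mul, norm_smul, RCLike.norm_ofReal, mul_pow,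
        sq_abs] at this
      linarith
    by_contra hne
    have hsq : 0 < (RCLike.re (f u) - ‖u‖ ^ 2) ^ 2 := by
      have := sub_ne_zero.2 hne
      positivity
    have hpos : 0 < ‖u‖ ^ 2 + 1 := by positivity
    -- With `d` the defect, `key` reads `t * d ≤ t² ‖u‖² / 2`, false for small `t ≠ 0` of the sign
    -- of `d`; the `+ 1` covers `u = 0`.
    have := key ((RCLike.re (f u) - ‖u‖ ^ 2) / (‖u‖ ^ 2 + 1))
    set d := RCLike.re (f u) - ‖u‖ ^ 2 with hd
    have hr : RCLike.re (f u) = d + ‖u‖ ^ 2 := by rw [hd]; ring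
    rw [hr] at this
    have h2 : d / (‖u‖ ^ 2 + 1) * d ≤ (d / (‖u‖ ^ 2 + 1)) ^ 2 / 2 * ‖u‖ ^ 2 := by linarith
    rw [div_mul_eq_mul_div, div_pow, div_div, div_mul_eq_mul_div,
      div_le_div_iff₀ hpos (by positivity)] at h2
    nlinarith [mul_pos hsq hpos, sq_nonneg ‖u‖, mul_nonneg hsq.le (sq_nonneg ‖u‖),
      mul_pos (mul_pos hsq hpos) hpos]
  have hre : ∀ z, RCLike.re (f z) ≤ (‖z‖ ^ 2 + ‖u‖ ^ 2) / 2 := by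
    intro z
    have := h z
    rw [map_sub, map_sub, hself] at this
    linarith
  have hnorm : ∀ z, ‖f z‖ ≤ (‖z‖ ^ 2 + ‖u‖ ^ 2) / 2 := by
    intro z
    obtain ⟨c, hc, hcz⟩ := RCLike.exists_norm_eq_mul_self (f z)
    have := hre (c • z)
    rw [map_smul, smul_eq_mul, ← hcz, RCLike.ofReal_re, norm_smul, hc, one_mul] at this
    exact this
  have hle : ∀ z, ‖f z‖ ≤ ‖u‖ * ‖z‖ := by
    intro z
    have key : ∀ t : ℝ, t * ‖f z‖ ≤ (t ^ 2 * ‖z‖ ^ 2 + ‖u‖ ^ 2) / 2 := by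
      intro t
      have := hnorm ((t : 𝕜) • z)
      rw [map_smul, norm_smul, norm_smul, RCLike.norm_ofReal, mul_pow, sq_abs] at this
      exact (mul_le_mul_of_nonneg_right (le_abs_self t) (norm_nonneg _)).trans this
    -- Scaling `z` by `t` gives a quadratic that is nonnegative for all real `t`.
    have hd := discrim_le_zero (a := ‖z‖ ^ 2) (b := -(2 * ‖f z‖)) (c := ‖u‖ ^ 2)
      (fun t => by nlinarith [key t])
    rw [discrim] at hd
    refine abs_le_of_sq_le_sq' ?_ (by positivity) |>.2
    nlinarith
  refine ⟨hle, ?_⟩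
  have hn := hle u
  rw [← sq, ← hself] at hn
  rw [← hself]
  exact (RCLike.re_eq_self_of_le hn).symm

/-! ### Semi-inner products as selections of support functionals -/

theorem IsNormSemiInnerProduct.exists_isSupportFunctional {s : E → E → 𝕜}
    (hs : IsNormSemiInnerProduct 𝕜 s) (u : E) :
    ∃ f : E →ₗ[𝕜] 𝕜, IsSupportFunctional u f ∧ ∀ v, f v = s u v := by
  have hadd : ∀ y z, s u (y + z) = s u y + s u z := fun y z => by
    simpa using (hs.add_mul_right u y z 1).symm
  have hzero : s u 0 = 0 := by simpa using hadd 0 0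
  have hsmul : ∀ (c : 𝕜) z, s u (c • z) = c * s u z := fun c z => by
    simpa [hzero] using (hs.add_mul_right u 0 z c).symm
  refine ⟨{ toFun := s u, map_add' := hadd, map_smul' := hsmul }, ⟨fun z => ?_, ?_⟩,
    fun v => rfl⟩
  · have := hs.norm_sq_le u z
    rw [hs.self_eq_norm_sq, hs.self_eq_norm_sq, RCLike.ofReal_re, RCLike.ofReal_re,
      ← mul_pow] at this
    exact abs_le_of_sq_le_sq' this (by positivity) |>.2
  · exact hs.self_eq_norm_sq u

open scoped ComplexOrder in
theorem isNormSemiInnerProduct_of_isSupportFunctional (J : E → E →ₗ[𝕜] 𝕜)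
    (hJ : ∀ u, IsSupportFunctional u (J u))
    (hsmul : ∀ (c : 𝕜) u v, J (c • u) v = starRingEnd 𝕜 c * J u v) :
    IsNormSemiInnerProduct 𝕜 fun u v => J u v where
  self_nonneg x := by
    rw [(hJ x).apply_self]
    exact RCLike.ofReal_nonneg.2 (by positivity)
  self_eq_zero_iff x := by
    rw [(hJ x).apply_self]
    simp
  add_mul_right x y z c := by simp
  smul_left := hsmul
  norm_sq_le x y := by
    rw [(hJ x).apply_self, (hJ y).apply_self, RCLike.ofReal_re, RCLike.ofReal_re, ← mul_pow]
    exact pow_le_pow_left₀ (norm_nonneg _) ((hJ x).norm_le y) 2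
  self_eq_norm_sq x := (hJ x).apply_self

/-- Every support functional is a section of a semi-inner product inducing the norm. -/
theorem IsSupportFunctional.exists_isNormSemiInnerProduct {u : E} {f : E →ₗ[𝕜] 𝕜}
    (hf : IsSupportFunctional u f) :
    ∃ s : E → E → 𝕜, IsNormSemiInnerProduct 𝕜 s ∧ ∀ v, s u v = f v := by
  classical
  -- Functionals are chosen only at one representative per orbit of `𝕜ˣ` and transported along it,
  -- which forces conjugate homogeneity.
  let r : E → E := fun z => (Quotient.mk (MulAction.orbitRel 𝕜ˣ E) z).out
  have hr : ∀ z, ∃ a : 𝕜ˣ, a • r z = z := fun z =>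
    MulAction.orbitRel_apply.1
      ((MulAction.orbitRel 𝕜ˣ E).symm (Quotient.mk_out (s := MulAction.orbitRel 𝕜ˣ E) z))
  have hr' : ∀ (c : 𝕜ˣ) z, r (c • z) = r z := fun c z =>
    congrArg Quotient.out (MulAction.orbitRel.Quotient.quotient_smul_eq (g := c) (a := z))
  choose a ha using hr
  choose φ hφ using fun z : E => exists_isSupportFunctional (𝕜 := 𝕜) z
  -- The rescaling of `f` is undone on transport back to `u`.
  let Φ : E → E →ₗ[𝕜] 𝕜 := fun z =>
    if z = r u then starRingEnd 𝕜 (↑(a u)⁻¹ : 𝕜) • f else φ z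
  have hΦ : ∀ z, IsSupportFunctional z (Φ z) := by
    intro z
    by_cases hz : z = r u
    · have : z = (↑(a u)⁻¹ : 𝕜) • u := by
        rw [hz, ← Units.smul_def, eq_inv_smul_iff, ha u]
      simp only [Φ, if_pos hz]
      nth_rewrite 1 [this]
      exact hf.smul _
    · simp only [Φ, if_neg hz]
      exact hφ z
  let J : E → E →ₗ[𝕜] 𝕜 := fun z => starRingEnd 𝕜 (a z : 𝕜) • Φ (r z)
  have hJ : ∀ z, IsSupportFunctional z (J z) := by
    intro z
    have := (hΦ (r z)).smul (a z : 𝕜)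
    rwa [← Units.smul_def, ha z] at this
  refine ⟨fun u v => J u v, isNormSemiInnerProduct_of_isSupportFunctional J hJ ?_, fun v => ?_⟩
  · intro c z v
    rcases eq_or_ne c 0 with rfl | hc
    · rw [(hJ _).apply_of_eq_zero (zero_smul 𝕜 z) v]
      simp
    rcases eq_or_ne z 0 with rfl | hz
    · rw [(hJ _).apply_of_eq_zero (smul_zero c) v, (hJ _).zero_apply v, mul_zero]
    · have hrz : r (c • z) = r z := hr' (Units.mk0 c hc) z
      have hac : (a (c • z) : 𝕜) = c * (a z : 𝕜) := by
        have h1 := ha (c • z)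
        rw [hrz] at h1
        have h2 : (a (c • z) : 𝕜) • r z = (c * (a z : 𝕜)) • r z := by
          rw [← Units.smul_def, h1, mul_smul, ← Units.smul_def, ha z]
        refine smul_left_injective 𝕜 (fun h0 => hz ?_) h2
        rw [← ha z, h0, smul_zero]
      simp only [J, hrz, hac, LinearMap.smul_apply, smul_eq_mul, map_mul, mul_assoc]
  · simp only [J, Φ, if_true, LinearMap.smul_apply, smul_eq_mul]
    rw [← mul_assoc, ← map_mul, Units.mul_inv, map_one, one_mul]

theorem isLeftSipSymmetric_iff {u : E} : IsLeftSipSymmetric 𝕜 u ↔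
    ∀ (v : E) (f : E →ₗ[𝕜] 𝕜), IsSupportFunctional u f →
      ∃ g : E →ₗ[𝕜] 𝕜, IsSupportFunctional v g ∧ g u = starRingEnd 𝕜 (f v) := by
  refine ⟨fun h v f hf => ?_, fun h v _ s hs => ?_⟩
  · rcases eq_or_ne v 0 with rfl | hv
    · obtain ⟨g, hg⟩ := exists_isSupportFunctional (𝕜 := 𝕜) (0 : E)
      exact ⟨g, hg, by simp [hg.zero_apply]⟩
    · obtain ⟨s, hs, hsf⟩ := hf.exists_isNormSemiInnerProduct
      obtain ⟨t, ht, hts⟩ := h v hv s hs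
      obtain ⟨g, hg, hgt⟩ := ht.exists_isSupportFunctional v
      exact ⟨g, hg, by rw [hgt, hts, hsf]; simp⟩
  · obtain ⟨f, hf, hfs⟩ := hs.exists_isSupportFunctional u
    obtain ⟨g, hg, hgu⟩ := h v f hf
    obtain ⟨t, ht, htg⟩ := hg.exists_isNormSemiInnerProduct
    exact ⟨t, ht, by rw [htg, hgu, hfs]; simp⟩

theorem isRightSipSymmetric_iff {u : E} : IsRightSipSymmetric 𝕜 u ↔
    ∀ (v : E) (g : E →ₗ[𝕜] 𝕜), IsSupportFunctional v g →
      ∃ f : E →ₗ[𝕜] 𝕜, IsSupportFunctional u f ∧ f v = starRingEnd 𝕜 (g u) := by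
  refine ⟨fun h v g hg => ?_, fun h v _ s hs => ?_⟩
  · rcases eq_or_ne v 0 with rfl | hv
    · obtain ⟨f, hf⟩ := exists_isSupportFunctional (𝕜 := 𝕜) u
      exact ⟨f, hf, by simp [hg.zero_apply]⟩
    · obtain ⟨s, hs, hsg⟩ := hg.exists_isNormSemiInnerProduct
      obtain ⟨t, ht, hts⟩ := h v hv s hs
      obtain ⟨f, hf, hft⟩ := ht.exists_isSupportFunctional u
      refine ⟨f, hf, ?_⟩
      rw [hft, ← hsg, hts]
      simp
  · obtain ⟨g, hg, hgs⟩ := hs.exists_isSupportFunctional v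
    obtain ⟨f, hf, hfv⟩ := h v g hg
    obtain ⟨t, ht, htf⟩ := hf.exists_isNormSemiInnerProduct
    refine ⟨t, ht, ?_⟩
    rw [htf, hfv, ← hgs]
    simp

theorem birkhoffOrthogonal_iff_exists_isSupportFunctional {u v : E} :
    BirkhoffOrthogonal 𝕜 u v ↔ ∃ f : E →ₗ[𝕜] 𝕜, IsSupportFunctional u f ∧ f v = 0 := by
  refine ⟨fun h => ?_, fun ⟨f, hf, hv⟩ => hf.birkhoffOrthogonal hv⟩
  obtain ⟨f, hf, hv⟩ := h.exists_isSupportFunctional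
  exact ⟨_, hf, hv⟩

end SupportFunctional

theorem hasSum_of_ne_of_ne {ι M : Type*} [AddCommMonoid M] [TopologicalSpace M] {a : ι → M}
    {n m : ι} (hnm : n ≠ m) (h : ∀ k, k ≠ n → k ≠ m → a k = 0) : HasSum a (a n + a m) := by
  classical
  rw [← Finset.sum_pair hnm]
  refine hasSum_sum_of_ne_finset_zero fun k hk => ?_
  simp only [Finset.mem_insert, Finset.mem_singleton, not_or] at hk
  exact h k hk.1 hk.2

/-! ### Orthogonality in the `ℓ²` sum -/

section LpSum

variable {𝕜 : Type*} [RCLike 𝕜] {X : ℕ → Type*} [∀ n, NormedAddCommGroup (X n)]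
  [∀ n, NormedSpace 𝕜 (X n)]

theorem lp.hasSum_norm_sq (x : lp X 2) : HasSum (fun n => ‖x n‖ ^ 2) (‖x‖ ^ 2) := by
  simpa using lp.hasSum_norm (p := 2) (by simp) x

theorem lp.norm_sq_add_single (x : lp X 2) (n : ℕ) (z : X n) :
    ‖x + lp.single 2 n (z - x n)‖ ^ 2 = ‖x‖ ^ 2 + (‖z‖ ^ 2 - ‖x n‖ ^ 2) := by
  have h := (lp.hasSum_norm_sq x).add (hasSum_ite_eq n (‖z‖ ^ 2 - ‖x n‖ ^ 2))
  refine (lp.hasSum_norm_sq _).unique (h.congr_fun fun k => ?_)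
  rcases eq_or_ne k n with rfl | hk
  · simp
  · simp [hk]

/-- The components of a support functional on the `ℓ²` sum are support functionals. -/
theorem IsSupportFunctional.lp_component {x : lp X 2} {F : lp X 2 →ₗ[𝕜] 𝕜}
    (hF : IsSupportFunctional x F) (n : ℕ) :
    IsSupportFunctional (x n) (F ∘ₗ lp.lsingle 2 n) := by
  refine .of_subgradient fun z => ?_
  have h1 := hF.norm_le (x + lp.single 2 n (z - x n))
  have h2 := (RCLike.re_le_norm _).trans h1
  have h3 := lp.norm_sq_add_single x n z
  rw [map_add, map_add, hF.apply_self, RCLike.ofReal_re] at h2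
  change RCLike.re (F (lp.single 2 n (z - x n))) ≤ _
  -- `ab ≤ (a² + b²) / 2` turns the norm bound into the subgradient inequality, where only
  -- coordinate `n` changes.
  nlinarith [sq_nonneg (‖x‖ - ‖x + lp.single 2 n (z - x n)‖)]

/-- Continuity of the James functional lets it pass through the coordinate sum; conversely,
Cauchy–Schwarz bounds `∑ fₙ ((x + c • y)ₙ) = ‖x‖²` by `‖x‖ ‖x + c • y‖`. -/
theorem birkhoffOrthogonal_lp_iff {x y : lp X 2} : BirkhoffOrthogonal 𝕜 x y ↔
    ∃ f : ∀ n, X n →ₗ[𝕜] 𝕜, (∀ n, IsSupportFunctional (x n) (f n)) ∧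
      HasSum (fun n => f n (y n)) 0 := by
  constructor
  · intro h
    obtain ⟨F, hF, hFy⟩ := h.exists_isSupportFunctional
    refine ⟨fun n => (F : lp X 2 →ₗ[𝕜] 𝕜) ∘ₗ lp.lsingle 2 n, hF.lp_component, ?_⟩
    rw [← hFy]
    exact (lp.hasSum_single (by simp) y).mapL F
  · rintro ⟨f, hf, hsum⟩ c
    rcases eq_or_ne x 0 with rfl | hx
    · simp
    have hx' : HasSum (fun n => f n (x n)) ((‖x‖ ^ 2 : ℝ) : 𝕜) := by
      simp only [(hf _).apply_self]
      exact RCLike.hasSum_ofReal 𝕜 |>.2 (lp.hasSum_norm_sq x)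
    have hxy : HasSum (fun n => f n ((x + c • y) n)) ((‖x‖ ^ 2 : ℝ) : 𝕜) := by
      have := hx'.add (hsum.mul_left c)
      rw [mul_zero, add_zero] at this
      refine this.congr_fun fun n => ?_
      rw [lp.coeFn_add, lp.coeFn_smul, Pi.add_apply, Pi.smul_apply, map_add, map_smul, smul_eq_mul]
    obtain ⟨hs, hle⟩ := lp.tsum_mul_le_mul_norm
      (by simpa using Real.HolderConjugate.two_two) x (x + c • y)
    have h1 : ‖((‖x‖ ^ 2 : ℝ) : 𝕜)‖ ≤ ∑' n, ‖x n‖ * ‖(x + c • y) n‖ := by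
      rw [← hxy.tsum_eq]
      exact tsum_of_norm_bounded hs.hasSum fun n => (hf n).norm_le _
    rw [RCLike.norm_ofReal, abs_of_nonneg (by positivity), sq] at h1
    exact le_of_mul_le_mul_left (h1.trans hle) (norm_pos_iff.2 hx)

theorem birkhoffOrthogonal_lp_iff_of_left {x y : lp X 2} {n : ℕ} (hx : ∀ k, k ≠ n → x k = 0) :
    BirkhoffOrthogonal 𝕜 x y ↔ BirkhoffOrthogonal 𝕜 (x n) (y n) := by
  rw [birkhoffOrthogonal_lp_iff, birkhoffOrthogonal_iff_exists_isSupportFunctional]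
  constructor
  · rintro ⟨f, hf, hsum⟩
    refine ⟨f n, hf n, (hasSum_single n fun k hk => ?_).unique hsum⟩
    exact (hf k).apply_of_eq_zero (hx k hk) _
  · rintro ⟨g, hg, hgy⟩
    choose φ hφ using fun k => exists_isSupportFunctional (𝕜 := 𝕜) (x k)
    refine ⟨Function.update φ n g, fun k => ?_, ?_⟩
    · rcases eq_or_ne k n with rfl | hk
      · simpa using hg
      · simpa [hk] using hφ k
    · convert hasSum_zero using 2 with k
      rcases eq_or_ne k n with rfl | hk
      · simpa using hgy
      · simpa [hk] using (hφ k).apply_of_eq_zero (hx k hk) _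

theorem birkhoffOrthogonal_lp_iff_of_right {x y : lp X 2} {n : ℕ} (hy : ∀ k, k ≠ n → y k = 0) :
    BirkhoffOrthogonal 𝕜 x y ↔ BirkhoffOrthogonal 𝕜 (x n) (y n) := by
  rw [birkhoffOrthogonal_lp_iff, birkhoffOrthogonal_iff_exists_isSupportFunctional]
  constructor
  · rintro ⟨f, hf, hsum⟩
    exact ⟨f n, hf n, (hasSum_single n fun k hk => by rw [hy k hk, map_zero]).unique hsum⟩
  · rintro ⟨g, hg, hgy⟩
    choose φ hφ using fun k => exists_isSupportFunctional (𝕜 := 𝕜) (x k)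
    refine ⟨Function.update φ n g, fun k => ?_, ?_⟩
    · rcases eq_or_ne k n with rfl | hk
      · simpa using hg
      · simpa [hk] using hφ k
    · convert hasSum_zero using 2 with k
      rcases eq_or_ne k n with rfl | hk
      · simpa using hgy
      · rw [hy k hk, map_zero]

/-! ### Necessity, by test vectors with at most two nonzero coordinates -/

theorem IsLeftSymmetric.of_lp {x : lp X 2} {n : ℕ} (hx : ∀ k, k ≠ n → x k = 0)
    (h : IsLeftSymmetric 𝕜 x) : IsLeftSymmetric 𝕜 (x n) := by
  intro v hv
  have h1 := h (lp.single 2 n v)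
  rw [birkhoffOrthogonal_lp_iff_of_left hx, birkhoffOrthogonal_lp_iff_of_right hx,
    lp.single_apply_self] at h1
  exact h1 hv

theorem IsRightSymmetric.of_lp {x : lp X 2} {n : ℕ} (hx : ∀ k, k ≠ n → x k = 0)
    (h : IsRightSymmetric 𝕜 x) : IsRightSymmetric 𝕜 (x n) := by
  intro v hv
  have h1 := h (lp.single 2 n v)
  rw [birkhoffOrthogonal_lp_iff_of_left hx, birkhoffOrthogonal_lp_iff_of_right hx,
    lp.single_apply_self] at h1
  exact h1 hv

theorem lp.single_add_single_left {n m : ℕ} (hnm : n ≠ m) (v : X n) (w : X m) :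
    (lp.single 2 n v + lp.single 2 m w : lp X 2) n = v := by
  simp [Pi.single_eq_of_ne hnm]

theorem lp.single_add_single_right {n m : ℕ} (hnm : n ≠ m) (v : X n) (w : X m) :
    (lp.single 2 n v + lp.single 2 m w : lp X 2) m = w := by
  simp [Pi.single_eq_of_ne hnm.symm]

theorem lp.single_add_single_of_ne {n m k : ℕ} (hn : k ≠ n) (hm : k ≠ m) (v : X n) (w : X m) :
    (lp.single 2 n v + lp.single 2 m w : lp X 2) k = 0 := by
  simp [Pi.single_eq_of_ne hn, Pi.single_eq_of_ne hm]

/-- A vector supported on two coordinates, parallel to `x` in the second one: orthogonality of `x`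
to it. -/
theorem birkhoffOrthogonal_single_add_smul_single_iff {x : lp X 2} {n m : ℕ} (hnm : n ≠ m)
    (v : X n) (c : 𝕜) :
    BirkhoffOrthogonal 𝕜 x (lp.single 2 n v + lp.single 2 m (c • x m)) ↔
      ∃ f : X n →ₗ[𝕜] 𝕜, IsSupportFunctional (x n) f ∧
        f v + c * ((‖x m‖ ^ 2 : ℝ) : 𝕜) = 0 := by
  rw [birkhoffOrthogonal_lp_iff]
  have key : ∀ f : ∀ k, X k →ₗ[𝕜] 𝕜, (∀ k, IsSupportFunctional (x k) (f k)) →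
      HasSum (fun k => f k ((lp.single 2 n v + lp.single 2 m (c • x m) : lp X 2) k))
        (f n v + c * ((‖x m‖ ^ 2 : ℝ) : 𝕜)) := by
    intro f hf
    have := hasSum_of_ne_of_ne
      (a := fun k => f k ((lp.single 2 n v + lp.single 2 m (c • x m) : lp X 2) k)) hnm
      (fun k hkn hkm => by rw [lp.single_add_single_of_ne hkn hkm, map_zero])
    simpa only [lp.single_add_single_left hnm, lp.single_add_single_right hnm, map_smul,
      (hf m).apply_self, smul_eq_mul] using this
  constructor
  · rintro ⟨f, hf, hsum⟩
    exact ⟨f n, hf n, (key f hf).unique hsum⟩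
  · rintro ⟨g, hg, hgv⟩
    choose φ hφ using fun k => exists_isSupportFunctional (𝕜 := 𝕜) (x k)
    have hf : ∀ k, IsSupportFunctional (x k) (Function.update φ n g k) := by
      intro k
      rcases eq_or_ne k n with rfl | hk
      · simpa using hg
      · simpa [hk] using hφ k
    refine ⟨_, hf, ?_⟩
    have := key _ hf
    rwa [Function.update_self, hgv] at this

/-- A vector supported on two coordinates, parallel to `x` in the second one: orthogonality of it
to `x`. -/
theorem single_add_smul_single_birkhoffOrthogonal_iff {x : lp X 2} {n m : ℕ} (hnm : n ≠ m)
    (v : X n) (c : 𝕜) :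
    BirkhoffOrthogonal 𝕜 (lp.single 2 n v + lp.single 2 m (c • x m)) x ↔
      ∃ g : X n →ₗ[𝕜] 𝕜, IsSupportFunctional v g ∧
        g (x n) + starRingEnd 𝕜 c * ((‖x m‖ ^ 2 : ℝ) : 𝕜) = 0 := by
  rw [birkhoffOrthogonal_lp_iff]
  set y : lp X 2 := lp.single 2 n v + lp.single 2 m (c • x m) with hy
  have hyn : y n = v := lp.single_add_single_left hnm _ _
  have hym : y m = c • x m := lp.single_add_single_right hnm _ _
  have key : ∀ f : ∀ k, X k →ₗ[𝕜] 𝕜, (∀ k, IsSupportFunctional (y k) (f k)) →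
      HasSum (fun k => f k (x k))
        (f n (x n) + starRingEnd 𝕜 c * ((‖x m‖ ^ 2 : ℝ) : 𝕜)) := by
    intro f hf
    have h1 := hf m
    rw [hym] at h1
    -- Any support functional at `c • x m` takes the same value at `x m`, even for `c = 0`.
    rw [← h1.smul_apply]
    exact hasSum_of_ne_of_ne (a := fun k => f k (x k)) hnm fun k hkn hkm =>
      (hf k).apply_of_eq_zero (lp.single_add_single_of_ne hkn hkm _ _) _
  constructor
  · rintro ⟨f, hf, hsum⟩
    exact ⟨f n, hyn ▸ hf n, (key f hf).unique hsum⟩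
  · rintro ⟨g, hg, hgv⟩
    choose φ hφ using fun k => exists_isSupportFunctional (𝕜 := 𝕜) (y k)
    have hf : ∀ k, IsSupportFunctional (y k) (Function.update φ n g k) := by
      intro k
      rcases eq_or_ne k n with rfl | hk
      · simpa [hyn] using hg
      · simpa [hk] using hφ k
    refine ⟨_, hf, ?_⟩
    have := key _ hf
    rwa [Function.update_self, hgv] at this

theorem IsLeftSymmetric.isLeftSipSymmetric_apply {x : lp X 2} (h : IsLeftSymmetric 𝕜 x)
    {n m : ℕ} (hnm : n ≠ m) (hm : x m ≠ 0) : IsLeftSipSymmetric 𝕜 (x n) := by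
  refine isLeftSipSymmetric_iff.2 fun v f hf => ?_
  have hne : ((‖x m‖ ^ 2 : ℝ) : 𝕜) ≠ 0 := by simpa using hm
  -- This `c` makes `x` orthogonal to the test vector; the reversed relation determines `g (x n)`.
  obtain ⟨c, hc⟩ : ∃ c : 𝕜, f v + c * ((‖x m‖ ^ 2 : ℝ) : 𝕜) = 0 :=
    ⟨-(f v / ((‖x m‖ ^ 2 : ℝ) : 𝕜)), by rw [neg_mul, div_mul_cancel₀ _ hne, add_neg_cancel]⟩
  obtain ⟨g, hg, hgx⟩ := (single_add_smul_single_birkhoffOrthogonal_iff hnm v _).1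
    (h _ ((birkhoffOrthogonal_single_add_smul_single_iff hnm v _).2 ⟨f, hf, hc⟩))
  refine ⟨g, hg, add_right_cancel (hgx.trans ?_)⟩
  simpa using (congrArg (starRingEnd 𝕜) hc).symm

theorem IsRightSymmetric.isRightSipSymmetric_apply {x : lp X 2} (h : IsRightSymmetric 𝕜 x)
    {n m : ℕ} (hnm : n ≠ m) (hm : x m ≠ 0) : IsRightSipSymmetric 𝕜 (x n) := by
  refine isRightSipSymmetric_iff.2 fun v g hg => ?_
  have hne : ((‖x m‖ ^ 2 : ℝ) : 𝕜) ≠ 0 := by simpa using hm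
  obtain ⟨c, hc⟩ : ∃ c : 𝕜, starRingEnd 𝕜 (g (x n)) + c * ((‖x m‖ ^ 2 : ℝ) : 𝕜) = 0 :=
    ⟨-(starRingEnd 𝕜 (g (x n)) / ((‖x m‖ ^ 2 : ℝ) : 𝕜)), by rw [neg_mul, div_mul_cancel₀ _ hne,
      add_neg_cancel]⟩
  obtain ⟨f, hf, hfv⟩ := (birkhoffOrthogonal_single_add_smul_single_iff hnm v _).1
    (h _ ((single_add_smul_single_birkhoffOrthogonal_iff hnm v _).2
      ⟨g, hg, by simpa using congrArg (starRingEnd 𝕜) hc⟩))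
  exact ⟨f, hf, add_right_cancel (hfv.trans hc.symm)⟩

/-! ### Sufficiency, by termwise conjugation, and the main theorem -/

theorem isLeftSymmetric_lp_of_isLeftSipSymmetric {x : lp X 2}
    (h : ∀ n, IsLeftSipSymmetric 𝕜 (x n)) : IsLeftSymmetric 𝕜 x := by
  intro y hxy
  obtain ⟨f, hf, hsum⟩ := birkhoffOrthogonal_lp_iff.1 hxy
  choose g hg hgx using fun n => isLeftSipSymmetric_iff.1 (h n) (y n) (f n) (hf n)
  refine birkhoffOrthogonal_lp_iff.2 ⟨g, hg, ?_⟩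
  simp only [hgx]
  simpa using RCLike.hasSum_conj' 𝕜 |>.2 (by simpa using hsum)

theorem isRightSymmetric_lp_of_isRightSipSymmetric {x : lp X 2}
    (h : ∀ n, IsRightSipSymmetric 𝕜 (x n)) : IsRightSymmetric 𝕜 x := by
  intro y hyx
  obtain ⟨g, hg, hsum⟩ := birkhoffOrthogonal_lp_iff.1 hyx
  choose f hf hfy using fun n => isRightSipSymmetric_iff.1 (h n) (y n) (g n) (hg n)
  refine birkhoffOrthogonal_lp_iff.2 ⟨f, hf, ?_⟩
  simp only [hfy]
  simpa using RCLike.hasSum_conj' 𝕜 |>.2 (by simpa using hsum)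

/-- Either `x` is supported on at most one coordinate, or for every `n` there is a nonzero
coordinate different from the `n`-th. -/
theorem lp.exists_support_subset_or_forall_exists_ne (x : lp X 2) :
    (∃ n₀, ∀ n, n ≠ n₀ → x n = 0) ∨ ∀ n, ∃ m, n ≠ m ∧ x m ≠ 0 := by
  by_contra! h
  obtain ⟨h1, n, h2⟩ := h
  obtain ⟨m, hm, hxm⟩ := h1 n
  exact hxm (h2 m hm.symm)

end LpSum

theorem mainTheorem10 {𝕜 : Type*} [RCLike 𝕜] {X : ℕ → Type*}
    [∀ n, NormedAddCommGroup (X n)] [∀ n, NormedSpace 𝕜 (X n)] (x : lp X 2) :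
    (IsLeftSymmetric 𝕜 x ↔
      (∀ n, IsLeftSipSymmetric 𝕜 (x n)) ∨
        ∃ n₀, (∀ n, n ≠ n₀ → x n = 0) ∧ IsLeftSymmetric 𝕜 (x n₀)) ∧
    (IsRightSymmetric 𝕜 x ↔
      (∀ n, IsRightSipSymmetric 𝕜 (x n)) ∨
        ∃ n₀, (∀ n, n ≠ n₀ → x n = 0) ∧ IsRightSymmetric 𝕜 (x n₀)) := by
  refine ⟨⟨fun h => ?_, ?_⟩, ⟨fun h => ?_, ?_⟩⟩
  · rcases lp.exists_support_subset_or_forall_exists_ne x with ⟨n₀, h₀⟩ | hne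
    · exact Or.inr ⟨n₀, h₀, h.of_lp h₀⟩
    · refine Or.inl fun n => ?_
      obtain ⟨m, hnm, hm⟩ := hne n
      exact h.isLeftSipSymmetric_apply hnm hm
  · rintro (h | ⟨n₀, h₀, h⟩)
    · exact isLeftSymmetric_lp_of_isLeftSipSymmetric h
    · intro y
      rw [birkhoffOrthogonal_lp_iff_of_left h₀, birkhoffOrthogonal_lp_iff_of_right h₀]
      exact h (y n₀)
  · rcases lp.exists_support_subset_or_forall_exists_ne x with ⟨n₀, h₀⟩ | hne
    · exact Or.inr ⟨n₀, h₀, h.of_lp h₀⟩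
    · refine Or.inl fun n => ?_
      obtain ⟨m, hnm, hm⟩ := hne n
      exact h.isRightSipSymmetric_apply hnm hm
  · rintro (h | ⟨n₀, h₀, h⟩)
    · exact isRightSymmetric_lp_of_isRightSipSymmetric h
    · intro y
      rw [birkhoffOrthogonal_lp_iff_of_left h₀, birkhoffOrthogonal_lp_iff_of_right h₀]
      exact h (y n₀)
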